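/- Let $t\ge 2$ and let $\mathcal Y,\mathcal Y_1,\dots,\mathcal Y_t$ be smooth projective curves over $\mathbb F_q$ with full constant field $\mathbb F_q$, with separable maps $h_j:\mathcal Y_j\to\mathcal Y$ of degree $d_{h_j}$ such that the extensions $\mathbb F_q(\mathcal Y_j)/\mathbb F_q(\mathcal Y)$ are linearly disjoint (as a family). Let $\mathcal X$ be the fiber product $\mathcal Y_1\times_{\mathcal Y}\cdots\times_{\mathcal Y}\mathcal Y_t$ (taken as the smooth projective curve whose function field is the compositum of the $\mathbb F_q(\mathcal Y_j)$), with natural map $g:\mathcal X\to\mathcal Y$ of degree $d_g=\prod_j d_{h_j}$. Let $y_j$ be a primitive element of $\mathbb F_q(\mathcal Y_j)/\mathbb F_q(\mathcal Y)$. Let $D$ be an effective divisor on $\mathcal Y$ and $S\subseteq\mathcal Y(\mathbb F_q)$ a finite set disjoint from $\operatorname{Supp} D$ such that, for every $P\in S$: $|g^{-1}(P)\cap\mathcal X(\mathbb F_q)|=d_g$; no $y_j$ has a pole at a point of $\mathcal X$ over $P$; and each $y_j$ takes distinct values at distinct $\mathbb F_q$-rational points of $\mathcal Y_j$ over $P$.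 Let $B=g^{-1}(S)\cap\mathcal X(\mathbb F_q)$, let $2\le H\le t$, and let $\rho_1,\dots,\rho_t$ be integers with $1\le\rho_j\le d_{h_j}$ for all $j$ and $\rho_j\ge 2$ for $j<H$. Let $$V=\operatorname{Span}_{\mathbb F_q}\{f\,y_1^{e_1}\cdots y_t^{e_t}: f\in\mathcal L(\mathcal Y,D),\ 0\le e_j\le d_{h_j}-\rho_j\}$$ and $C=C(D,B)=\{(f(Q))_{Q\in B}: f\in V\}$. For $j\in\{1,\dots,H\}$ and $Q\in B$ let $(C_j)_Q$ be the punctured code of $C$ whose support consists of the points of $B$ that have the same image as $Q$ on the fiber product over $\mathcal Y$ of all $\mathcal Y_i$ with $i\notin\{j,j+1,\dots,H\}$. Put $$n_j=\prod_{k=j}^H d_{h_k},\qquad s_j=\prod_{k=j}^H(d_{h_k}-\rho_k+1),\qquad \delta_j=\prod_{k=j}^H\rho_k .$$ Then $C$ has $H$-level hierarchical locality with parameters $[(n_1,s_1,\delta_1),\dots,(n_H,s_H,\delta_H)]$ through the codes $(C_j)_Q$. That is: $n_1>\dots>n_H\geq 1$, $s_1\ge\dots\ge s_H\geq 1$, $\delta_1>\dots>\delta_H\geq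 1$; for every $Q\in B$ the supports of $(C_1)_Q,\dots,(C_H)_Q$ form a decreasing chain of sets containing $Q$; each $(C_j)_Q$ has length $n_j$, dimension at most $s_j$ and minimum distance at least $\delta_j$; and, if $Q'$ is in the support of $(C_j)_Q$ and $j<k\le H$, then the support of $(C_k)_{Q'}$ is contained in that of $(C_j)_Q$, so that $(C_j)_Q$ in turn has $(H-j)$-level hierarchical locality through the codes $(C_k)_{Q'}$, $j<k\le H$. -/

import Mathlib

/-! ### Linear codes and hierarchical locality

A linear code with coordinate set `ι` over `k` is a subspace of `ι → k`. -/

section Codes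

variable {k : Type*} [Field k] {ι : Type*}

/-- The punctured code `C|_I`: all codewords restricted to the coordinates in `I`. -/
def puncturedCode (C : Submodule k (ι → k)) (I : Set ι) : Submodule k (I → k) :=
  C.map (LinearMap.funLeft k k (Subtype.val : I → ι))

/-- Any two distinct codewords differ in at least `δ` coordinates. -/
def MinDistAtLeast (C : Submodule k (ι → k)) (δ : ℕ) : Prop :=
  ∀ c ∈ C, ∀ c' ∈ C, c ≠ c' → (δ : ℕ∞) ≤ {i | c i ≠ c' i}.encard

/-- `C` has `H`-level hierarchical locality with parameters `(n j, s j, δ j)`, `j : Fin H`, where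
the `j`-th middle code for position `i` is the punctured code of `C` with support `A j i`.
The level `j` is counted from `0`, so `j = 0` is the largest middle code.

The field `recursive` says that every middle code again has hierarchical locality through the
middle codes of the deeper levels: each position `i'` of the `j`-th middle code for `i` has its own
chain of middle codes `A l i'`, `j < l`, and these are punctured codes of that `j`-th middle code
(their lengths, dimensions, distances and nesting are governed by the other fields at `i'`). -/
structure HasHierarchicalLocalityVia (C : Submodule k (ι → k)) {H : ℕ} (n s δ : Fin H → ℕ)
    (A : Fin H → ι → Set ι) : Prop where
  two_le : 2 ≤ H
  n_pos : ∀ j, 0 < n j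
  s_pos : ∀ j, 0 < s j
  δ_pos : ∀ j, 0 < δ j
  n_strictAnti : StrictAnti n
  s_antitone : Antitone s
  δ_strictAnti : StrictAnti δ
  mem : ∀ j i, i ∈ A j i
  length : ∀ j i, (A j i).encard = n j
  nested : ∀ i, Antitone fun j => A j i
  dim_le : ∀ j i, Module.finrank k (puncturedCode C (A j i)) ≤ s j
  dist : ∀ j i, MinDistAtLeast (puncturedCode C (A j i)) (δ j)
  recursive : ∀ j l, j < l → ∀ i, ∀ i' ∈ A j i, A l i' ⊆ A j i

end Codes

/-! ### Curves through their function fields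

A smooth projective curve over `k` with full constant field `k` is given by its function field, its
closed points are the places of that field, its `k`-rational points are the places of degree one,
and a nonconstant map of curves is an inclusion of function fields, acting on points by
restriction of places. -/

section Curves

variable (k : Type*) [Field k]

/-- `F` is an algebraic function field of one variable over `k`, with full constant field `k`. -/
structure IsCurveFunctionField (F : Type*) [Field F] [Algebra k F] : Prop where
  exists_transcendental : ∃ x : F, Transcendental k x ∧
    FiniteDimensional (IntermediateField.adjoin k {x}) F
  full_constants : ∀ x : F, IsAlgebraic k x → x ∈ (algebraMap k F).range

/-- A place of `F / k`, given by its valuation ring: a valuation ring of `F`, different from `F`,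
that contains `k`. -/
structure Place (F : Type*) [Field F] [Algebra k F] where
  ring : ValuationSubring F
  algebraMap_mem : ∀ c : k, algebraMap k F c ∈ ring
  ne_top : ring ≠ ⊤

namespace Place

variable {k} {F K L : Type*} [Field F] [Algebra k F] [Field K] [Algebra k K]
  [Field L] [Algebra k L] [Algebra K L]

/-- `f` is regular at `P` and takes there the value `c ∈ k`, that is, `f - c` lies in the maximal
ideal of the valuation ring of `P`. -/
def HasValue (P : Place k F) (f : F) (c : k) : Prop :=
  f - algebraMap k F c ∈ P.ring.nonunits

/-- `P` is a `k`-rational point: its residue field is `k`. -/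
def IsRational (P : Place k F) : Prop :=
  ∀ f ∈ P.ring, ∃ c : k, P.HasValue f c

/-- The place `Q` of `L` lies over the place `P` of `K`: the map of curves belonging to the
inclusion of `K` in `L` sends the point `Q` to the point `P`. -/
def LiesOver (Q : Place k L) (P : Place k K) : Prop :=
  Q.ring.comap (algebraMap K L) = P.ring

/-- The points `Q` and `Q'` have the same image on the curve with function field `M ⊆ L`. -/
def SameImage (M : IntermediateField K L) (Q Q' : Place k L) : Prop :=
  Q.ring.comap (algebraMap M L) = Q'.ring.comap (algebraMap M L)

theorem HasValue.add {P : Place k F} {f g : F} {a b : k} (hf : P.HasValue f a)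
    (hg : P.HasValue g b) : P.HasValue (f + g) (a + b) := by
  unfold HasValue at *
  rw [ValuationSubring.mem_nonunits_iff] at *
  have h : f + g - algebraMap k F (a + b) = (f - algebraMap k F a) + (g - algebraMap k F b) := by
    rw [map_add]; ring
  rw [h]
  exact P.ring.valuation.map_add_lt hf hg

theorem HasValue.smul {P : Place k F} {f : F} {a : k} (c : k) (hf : P.HasValue f a) :
    P.HasValue (c • f) (c * a) := by
  unfold HasValue at *
  rw [ValuationSubring.mem_nonunits_iff] at *
  have h : c • f - algebraMap k F (c * a) = algebraMap k F c * (f - algebraMap k F a) := by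
    rw [map_mul, Algebra.smul_def]; ring
  rw [h, map_mul]
  exact mul_lt_one_of_nonneg_of_lt_one_right
    ((P.ring.valuation_le_one_iff _).2 (P.algebraMap_mem c)) zero_le hf

theorem HasValue.zero (P : Place k F) : P.HasValue 0 0 := by
  unfold HasValue
  rw [ValuationSubring.mem_nonunits_iff]
  simp

end Place

/-- The Riemann–Roch space `ℒ(D)` of an effective divisor `D`: the functions `f` with
`v_P(f) ≥ -D(P)` at all places `P`, that is, `f • 𝔪_P ^ D(P) ⊆ 𝒪_P`. -/
def riemannRochSpace {k : Type*} [Field k] {F : Type*} [Field F] [Algebra k F]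
    (D : Place k F →₀ ℕ) : Submodule k F where
  carrier := {f | ∀ P : Place k F, ∀ x ∈ (IsLocalRing.maximalIdeal P.ring) ^ (D P),
    f * (x : F) ∈ P.ring}
  add_mem' := fun {f g} hf hg P x hx => by
    rw [add_mul]
    exact P.ring.add_mem _ _ (hf P x hx) (hg P x hx)
  zero_mem' := fun P x _ => by
    rw [zero_mul]
    exact P.ring.zero_mem
  smul_mem' := fun c f hf P x hx => by
    rw [Algebra.smul_def, mul_assoc]
    exact P.ring.mul_mem _ _ (P.algebraMap_mem c) (hf P x hx)

end Curves

/-! ### Fiber product codes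

`K` is the function field of the base curve `𝒴`, `E j` that of the curve `𝒴_j`, and `L`, the
compositum of the `E j`, that of the fiber product `𝒳` of the `𝒴_j` over `𝒴`. -/

section FiberProduct

variable {k K L : Type*} [Field k] [Field K] [Field L] [Algebra k K] [Algebra k L] [Algebra K L]
  [IsScalarTower k K L] {t : ℕ}

/-- The function field of the partial fiber product over `𝒴` of all `𝒴_i` with `i ∉ A`. -/
def partialCompositum (E : Fin t → IntermediateField K L) (A : Set (Fin t)) :
    IntermediateField K L :=
  ⨆ i ∈ Aᶜ, E i

/-- The extensions `E j / K` are linearly disjoint (as a family). -/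
def LinearlyDisjointFamily (E : Fin t → IntermediateField K L) : Prop :=
  ∀ j, (E j).LinearDisjoint (partialCompositum E {j})

/-- The evaluation points: the rational points of `𝒳` that map into `S` under `g : 𝒳 → 𝒴`. -/
def evaluationPoints (L : Type*) [Field L] [Algebra k L] [Algebra K L]
    (S : Finset (Place k K)) : Set (Place k L) :=
  {Q | Q.IsRational ∧ ∃ P ∈ S, Q.LiesOver P}

/-- The space `V` spanned by the functions `f * ∏ j, y j ^ e j`, where `f ∈ ℒ(D)` and
`e j ≤ d j - ρ j` for all `j`, with `d j = [E j : K]` the degree of `𝒴_j → 𝒴`. -/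
def evaluationSpace (E : Fin t → IntermediateField K L) (y : ∀ j, E j) (ρ : Fin t → ℕ)
    (D : Place k K →₀ ℕ) : Submodule k L :=
  Submodule.span k {v | ∃ f ∈ riemannRochSpace D, ∃ e : Fin t → ℕ,
    (∀ j, e j + ρ j ≤ Module.finrank K (E j)) ∧
    v = algebraMap K L f * ∏ j, (y j : L) ^ e j}

/-- The code of all vectors of values `(f Q)`, `Q ∈ B`, of the functions `f ∈ V`. -/
def evaluationCode (V : Submodule k L) (B : Set (Place k L)) : Submodule k (B → k) where
  carrier := {c | ∃ f ∈ V, ∀ Q : B, Q.1.HasValue f (c Q)}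
  add_mem' := by
    rintro a b ⟨f, hf, hfa⟩ ⟨g, hg, hgb⟩
    exact ⟨f + g, V.add_mem hf hg, fun Q => (hfa Q).add (hgb Q)⟩
  zero_mem' := ⟨0, V.zero_mem, fun Q => Place.HasValue.zero Q.1⟩
  smul_mem' := by
    rintro c a ⟨f, hf, hfa⟩
    exact ⟨c • f, V.smul_mem c hf, fun Q => (hfa Q).smul c⟩

/-- The fiber product code `C(D, B)`, with `B` the set of rational points of `𝒳` over `S`. -/
def fiberProductCode (E : Fin t → IntermediateField K L) (y : ∀ j, E j) (ρ : Fin t → ℕ)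
    (D : Place k K →₀ ℕ) (S : Finset (Place k K)) :
    Submodule k (evaluationPoints L S → k) :=
  evaluationCode (evaluationSpace E y ρ D) (evaluationPoints L S)

/-- The fiber in the set of evaluation points, through the point `Q`, of the map from `𝒳` to the
partial fiber product of all `𝒴_i` with `i ∉ A`. -/
def fiberThrough (E : Fin t → IntermediateField K L) (S : Finset (Place k K)) (A : Set (Fin t))
    (Q : evaluationPoints L S) : Set (evaluationPoints L S) :=
  {Q' | Place.SameImage (partialCompositum E A) Q.1 Q'.1}

end FiberProduct

/-! Fix `P ∈ S` and write `d_j = [E j : K]`. Recording the values of the `y j` identifies the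
evaluation points over `P` with a full grid `∏ G_j`, `|G_j| = d_j`, and turns the map to a partial
fiber product into the projection that forgets the coordinates in `A` (`exists_coordinates`). A
function in `ℒ(D)` comes from `K` and is regular at `P`, so it is constant on this fiber. Hence
functions in `V` become polynomials of degree at most `d_j - ρ_j` in the `j`-th coordinate, and each
middle code lies in a product of Reed–Solomon codes of lengths `d_j`, dimensions `d_j - ρ_j + 1` and
distances `ρ_j`, `j ∈ A` (`fiberThrough_parameters`).

The real content is that the whole grid is hit. Both sides have `[L : K]` elements, by complete
splitting and linear disjointness, so surjectivity suffices. Choose functions `b j` on `𝒴_j` dual to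
its points over `P`. Their products `ε x` form a basis of an order over the local ring `O` of `P`,
and each is idempotent modulo the maximal ideal `m`. If no point had coordinates `x`, then `ε x`
would vanish at every rational point over `P`. Then `(1 - ε x)⁻¹` would be regular at all of them,
hence integral over `O`, hence in the order. This forces `ε x = (ε x - ε x ^ 2) * (1 - ε x)⁻¹` into
`m` times the order, which is impossible for a basis element (`not_isIntegral_inv_one_sub`,
`exists_hasValue_prod_ne_zero`). -/

/-! ### Values at rational places and dual families of functions. -/

section RationalPlaces

namespace Place

variable {k F : Type*} [Field k] [Field F] [Algebra k F] {P Q : Place k F} {f g : F} {a b c : k}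

theorem hasValue_zero_iff : P.HasValue f 0 ↔ f ∈ P.ring.nonunits := by
  simp [HasValue]

theorem hasValue_algebraMap (P : Place k F) (c : k) : P.HasValue (algebraMap k F c) c := by
  simp [HasValue]

theorem hasValue_one (P : Place k F) : P.HasValue 1 1 := by
  simpa using P.hasValue_algebraMap 1

theorem HasValue.mem_ring (h : P.HasValue f a) : f ∈ P.ring := by
  have := P.ring.add_mem _ _ (P.ring.nonunits_subset h) (P.algebraMap_mem a)
  simpa using this

theorem mul_mem_nonunits (hf : f ∈ P.ring) (hg : g ∈ P.ring.nonunits) :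
    f * g ∈ P.ring.nonunits := by
  rw [ValuationSubring.mem_nonunits_iff] at *
  rw [map_mul]
  exact mul_lt_one_of_nonneg_of_lt_one_right ((P.ring.valuation_le_one_iff _).2 hf) zero_le hg

theorem HasValue.mul (hf : P.HasValue f a) (hg : P.HasValue g b) : P.HasValue (f * g) (a * b) := by
  have h : f * g - algebraMap k F (a * b) =
      f * (g - algebraMap k F b) + algebraMap k F b * (f - algebraMap k F a) := by
    rw [map_mul]; ring
  unfold HasValue
  rw [h]
  exact add_mem (mul_mem_nonunits hf.mem_ring hg) (mul_mem_nonunits (P.algebraMap_mem b) hf)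

theorem HasValue.neg (hf : P.HasValue f a) : P.HasValue (-f) (-a) := by
  simpa using hf.smul (-1)

theorem HasValue.sub (hf : P.HasValue f a) (hg : P.HasValue g b) : P.HasValue (f - g) (a - b) := by
  simpa [sub_eq_add_neg] using hf.add hg.neg

theorem HasValue.pow (hf : P.HasValue f a) (n : ℕ) : P.HasValue (f ^ n) (a ^ n) := by
  induction n with
  | zero => simpa using P.hasValue_one
  | succ n ih => simpa [pow_succ] using ih.mul hf

theorem HasValue.prod {ι : Type*} {s : Finset ι} {f : ι → F} {a : ι → k}
    (h : ∀ i ∈ s, P.HasValue (f i) (a i)) : P.HasValue (∏ i ∈ s, f i) (∏ i ∈ s, a i) := by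
  classical
  induction s using Finset.induction_on with
  | empty => simpa using P.hasValue_one
  | insert i s hi ih =>
    rw [Finset.prod_insert hi, Finset.prod_insert hi]
    exact (h i (by simp)).mul (ih fun j hj => h j (by simp [hj]))

theorem algebraMap_mem_nonunits_iff : algebraMap k F c ∈ P.ring.nonunits ↔ c = 0 := by
  rw [ValuationSubring.mem_nonunits_iff_or, ← map_inv₀, map_eq_zero]
  exact or_iff_left (not_not.2 (P.algebraMap_mem _))

theorem HasValue.unique (hf : P.HasValue f a) (hg : P.HasValue f b) : a = b := by
  have h := hf.sub hg
  rw [sub_self] at h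
  have h2 := P.ring.nonunits.neg_mem h
  rw [zero_sub, neg_neg, algebraMap_mem_nonunits_iff] at h2
  exact sub_eq_zero.1 h2

theorem HasValue.valuation_eq_one (hf : P.HasValue f a) (ha : a ≠ 0) :
    P.ring.valuation f = 1 := by
  refine le_antisymm ((P.ring.valuation_le_one_iff _).2 hf.mem_ring) (not_lt.1 fun h => ha ?_)
  exact hf.unique (hasValue_zero_iff.2 ((ValuationSubring.mem_nonunits_iff _).2 h))

theorem HasValue.inv (hf : P.HasValue f a) (ha : a ≠ 0) : P.HasValue f⁻¹ a⁻¹ := by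
  have hv := hf.valuation_eq_one ha
  have hf0 : f ≠ 0 := by
    rintro rfl
    simp at hv
  have ha0 : algebraMap k F a ≠ 0 := by simpa using ha
  have hm : (algebraMap k F a)⁻¹ * f⁻¹ ∈ P.ring := by
    refine P.ring.mul_mem _ _ ?_ ?_
    · rw [← map_inv₀]; exact P.algebraMap_mem _
    · rw [← ValuationSubring.valuation_le_one_iff, map_inv₀, hv, inv_one]
  have h := P.ring.nonunits.neg_mem (mul_mem_nonunits hm hf)
  have e : f⁻¹ - algebraMap k F a⁻¹ =
      -((algebraMap k F a)⁻¹ * f⁻¹ * (f - algebraMap k F a)) := by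
    rw [map_inv₀]; field_simp; ring
  unfold HasValue
  rwa [e]

theorem hasValue_zero_inv_of_notMem (hf : f ∉ P.ring) : P.HasValue f⁻¹ 0 :=
  hasValue_zero_iff.2 ((ValuationSubring.inv_mem_nonunits_iff _).2 (Or.inr hf))

/-- At a rational place, the value of `(f ^ q - f + 1)⁻¹` detects whether `f` has a pole. -/
theorem IsRational.hasValue_inv_poly [Finite k] (hP : P.IsRational) (f : F)
    [Decidable (f ∈ P.ring)] :
    P.HasValue (f ^ Nat.card k - f + 1)⁻¹ (if f ∈ P.ring then 1 else 0) := by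
  have := Fintype.ofFinite k
  split_ifs with hf
  · obtain ⟨c, hc⟩ := hP f hf
    have h := ((hc.pow (Nat.card k)).sub hc).add P.hasValue_one
    rw [Nat.card_eq_fintype_card, FiniteField.pow_card, sub_self, zero_add] at h
    simpa [Nat.card_eq_fintype_card] using h.inv one_ne_zero
  · have hf0 : f ≠ 0 := fun h => hf (h ▸ P.ring.zero_mem)
    have hq : 1 < Nat.card k := Finite.one_lt_card
    obtain ⟨n, hn⟩ : ∃ n, Nat.card k = n + 2 := ⟨Nat.card k - 2, by omega⟩
    have hz := hasValue_zero_inv_of_notMem hf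
    -- At a pole, factor out `f ^ (n + 2)`: what remains is a polynomial in `f⁻¹` with value `1`.
    have h := (hz.pow (n + 2)).mul
      (((P.hasValue_one.sub (hz.pow (n + 1))).add (hz.pow (n + 2))).inv (by simp))
    have e : (f ^ (n + 2) - f + 1)⁻¹ =
        f⁻¹ ^ (n + 2) * (1 - f⁻¹ ^ (n + 1) + f⁻¹ ^ (n + 2))⁻¹ := by
      rw [inv_pow f (n + 2), ← mul_inv]
      congr 1
      have h1 : f ^ (n + 2) * f⁻¹ ^ (n + 1) = f := by
        rw [inv_pow, pow_succ f (n + 1), mul_right_comm, mul_inv_cancel₀ (pow_ne_zero _ hf0), one_mul]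
      rw [mul_add, mul_sub, mul_one, h1, mul_inv_cancel₀ (pow_ne_zero _ hf0)]
    rw [hn, e]
    simpa using h

theorem ext_ring (h : P.ring = Q.ring) : P = Q := by
  cases P; cases Q; simpa using h

/-- A larger valuation ring has a smaller maximal ideal, so `f - c` in the maximal ideal of `Q` is
also in that of `P`. Thus distinct rational places have incomparable rings, which supplies the
separating functions below. -/
theorem IsRational.eq_of_le (hQ : Q.IsRational) (h : P.ring ≤ Q.ring) :
    P = Q := by
  refine ext_ring (le_antisymm h fun f hf => ?_)
  obtain ⟨c, hc⟩ := hQ f hf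
  have : P.HasValue f c := ValuationSubring.nonunits_le_nonunits.2 h hc
  exact this.mem_ring

/-- A substitute for weak approximation over a finite field. A function regular at `R i` with a pole
at `R j` is turned by `f ↦ (f ^ q - f + 1)⁻¹` into one with values in `{0, 1}` at all the places. -/
theorem exists_dual_family [Finite k] {ι : Type*} [Fintype ι] [DecidableEq ι] {R : ι → Place k F}
    (hR : ∀ i, (R i).IsRational) (hinj : Function.Injective R) :
    ∃ b : ι → F, ∀ i j, (R j).HasValue (b i) (if i = j then 1 else 0) := by
  classical
  have key : ∀ i j, ∃ s : F, (∀ l, ∃ c, (R l).HasValue s c) ∧ (R i).HasValue s 1 ∧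
      (i ≠ j → (R j).HasValue s 0) := by
    intro i j
    by_cases hij : i = j
    · exact ⟨1, fun l => ⟨1, (R l).hasValue_one⟩, (R i).hasValue_one, fun h => absurd hij h⟩
    · obtain ⟨f, hfi, hfj⟩ : ∃ f ∈ (R i).ring, f ∉ (R j).ring := by
        by_contra! h
        exact hij (hinj ((hR j).eq_of_le h))
      refine ⟨(f ^ Nat.card k - f + 1)⁻¹, fun l => ⟨_, (hR l).hasValue_inv_poly f⟩, ?_, fun _ => ?_⟩
      · simpa [hfi] using (hR i).hasValue_inv_poly f
      · simpa [hfj] using (hR j).hasValue_inv_poly f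
  choose s hs hs1 hs0 using key
  choose v hv using hs
  -- The factor `s i l` kills the product at `R l`, while every factor is `1` at `R i`.
  refine ⟨fun i => ∏ j, s i j, fun i l => ?_⟩
  split_ifs with h
  · subst h
    simpa using HasValue.prod (s := Finset.univ) fun j _ => hs1 i j
  · have hp := HasValue.prod (s := Finset.univ) fun j _ => hv i j l
    rwa [Finset.prod_eq_zero (f := fun j => v i j l) (Finset.mem_univ l)
      ((hv i l l).unique (hs0 i l h))] at hp

end Place

end RationalPlaces

/-! ### Dual families over a place of the base field. -/

section Extensions

namespace Place

variable {k K L : Type*} [Field k] [Field K] [Field L] [Algebra k K] [Algebra k L] [Algebra K L]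
  {P : Place k K} {Q : Place k L}

theorem LiesOver.mem_iff (h : Q.LiesOver P) {x : K} : algebraMap K L x ∈ Q.ring ↔ x ∈ P.ring := by
  rw [← h]; rfl

theorem LiesOver.mem_nonunits_iff (h : Q.LiesOver P) {x : K} :
    algebraMap K L x ∈ Q.ring.nonunits ↔ x ∈ P.ring.nonunits := by
  rw [ValuationSubring.mem_nonunits_iff_or, ValuationSubring.mem_nonunits_iff_or, ← map_inv₀,
    h.mem_iff]
  simp

theorem LiesOver.hasValue_iff [IsScalarTower k K L] (h : Q.LiesOver P) {x : K} {c : k} :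
    Q.HasValue (algebraMap K L x) c ↔ P.HasValue x c := by
  unfold HasValue
  rw [← h.mem_nonunits_iff, map_sub, ← IsScalarTower.algebraMap_apply]

theorem LiesOver.isRational [IsScalarTower k K L] (h : Q.LiesOver P) (hQ : Q.IsRational) :
    P.IsRational := fun f hf => by
  obtain ⟨c, hc⟩ := hQ _ (h.mem_iff.2 hf)
  exact ⟨c, h.hasValue_iff.1 hc⟩

variable {ι : Type*} [Fintype ι] [DecidableEq ι] {R : ι → Place k L} {b : ι → L}

/-- Divide by a coefficient `a i` of largest valuation: the sum then has value `b i (R i) = 1` at `R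
i`, since the other terms vanish there. So integrality, vanishing and independence of coefficients
can be read off from the values of the sum. -/
theorem exists_dominant_coeff [Nonempty ι] (hR : ∀ i, (R i).LiesOver P)
    (hb : ∀ i j, (R j).HasValue (b i) (if i = j then 1 else 0)) (a : ι → K) :
    ∃ i, (∀ j, P.ring.valuation (a j) ≤ P.ring.valuation (a i)) ∧
      (R i).ring.valuation (∑ j, a j • b j) = (R i).ring.valuation (algebraMap K L (a i)) := by
  obtain ⟨i, hi⟩ := Finite.exists_max fun j => P.ring.valuation (a j)
  refine ⟨i, hi, ?_⟩
  by_cases h0 : a i = 0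
  · have : ∀ j, a j = 0 := fun j => by simpa [h0] using hi j
    simp [this]
  have hterm : ∀ j, (algebraMap K L (a j / a i) * b j - if j = i then 1 else 0) ∈
      (R i).ring.nonunits := by
    intro j
    split_ifs with hj
    · subst hj
      have := hb j j
      rw [div_self h0]
      simpa [HasValue] using this
    · rw [sub_zero]
      refine mul_mem_nonunits ((hR i).mem_iff.2 ?_) ?_
      · rw [← ValuationSubring.valuation_le_one_iff, map_div₀]
        exact div_le_one_of_le₀ (hi j) zero_le
      · simpa [hj, hasValue_zero_iff] using hb j i
  have hsum : (R i).HasValue (∑ j, algebraMap K L (a j / a i) * b j) 1 := by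
    have := sum_mem (S := (R i).ring.nonunits) (t := Finset.univ) fun j _ => hterm j
    simpa [HasValue, Finset.sum_sub_distrib] using this
  have e : ∑ j, a j • b j = algebraMap K L (a i) * ∑ j, algebraMap K L (a j / a i) * b j := by
    rw [Finset.mul_sum]
    refine Finset.sum_congr rfl fun j _ => ?_
    rw [← mul_assoc, ← map_mul, mul_div_cancel₀ _ h0, Algebra.smul_def]
  rw [e, map_mul, hsum.valuation_eq_one one_ne_zero, mul_one]

theorem coeff_mem_ring (hR : ∀ i, (R i).LiesOver P)
    (hb : ∀ i j, (R j).HasValue (b i) (if i = j then 1 else 0)) {a : ι → K}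
    (h : ∀ i, ∑ j, a j • b j ∈ (R i).ring) (i : ι) : a i ∈ P.ring := by
  have : Nonempty ι := ⟨i⟩
  obtain ⟨l, hl, hv⟩ := exists_dominant_coeff hR hb a
  have h1 : a l ∈ P.ring := by
    rw [← (hR l).mem_iff, ← ValuationSubring.valuation_le_one_iff, ← hv]
    exact (ValuationSubring.valuation_le_one_iff _ _).2 (h l)
  rw [← ValuationSubring.valuation_le_one_iff] at h1 ⊢
  exact (hl i).trans h1

theorem coeff_mem_nonunits (hR : ∀ i, (R i).LiesOver P)
    (hb : ∀ i j, (R j).HasValue (b i) (if i = j then 1 else 0)) {a : ι → K}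
    (h : ∀ i, ∑ j, a j • b j ∈ (R i).ring.nonunits) (i : ι) : a i ∈ P.ring.nonunits := by
  have : Nonempty ι := ⟨i⟩
  obtain ⟨l, hl, hv⟩ := exists_dominant_coeff hR hb a
  have h1 : a l ∈ P.ring.nonunits := by
    rw [← (hR l).mem_nonunits_iff, ValuationSubring.mem_nonunits_iff, ← hv]
    exact h l
  rw [ValuationSubring.mem_nonunits_iff] at h1 ⊢
  exact (hl i).trans_lt h1

theorem linearIndependent_of_dual (hR : ∀ i, (R i).LiesOver P)
    (hb : ∀ i j, (R j).HasValue (b i) (if i = j then 1 else 0)) : LinearIndependent K b := by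
  rw [Fintype.linearIndependent_iff]
  intro a ha i
  have : Nonempty ι := ⟨i⟩
  obtain ⟨l, hl, hv⟩ := exists_dominant_coeff hR hb a
  have h0 : a l = 0 := by simpa [ha] using hv.symm
  simpa [h0] using hl i

/-- A function regular at `[L : K]` rational places over `P` is integral over the local ring. -/
theorem isIntegral_of_forall_mem [Finite k] (hrat : ∀ i, (R i).IsRational)
    (hinj : Function.Injective R) (hR : ∀ i, (R i).LiesOver P)
    (hcard : Fintype.card ι = Module.finrank K L) [Nonempty ι] {z : L}
    (hz : ∀ i, z ∈ (R i).ring) : IsIntegral P.ring z := by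
  obtain ⟨b, hb⟩ := exists_dual_family hrat hinj
  have hli := linearIndependent_of_dual hR hb
  let B := basisOfLinearIndependentOfCardEqFinrank hli hcard
  have hB : ∀ i, B i = b i := fun i => by simp [B]
  let A : Subalgebra P.ring L :=
    { carrier := {x | ∀ i, x ∈ (R i).ring}
      mul_mem' := fun hx hy i => mul_mem (hx i) (hy i)
      add_mem' := fun hx hy i => add_mem (hx i) (hy i)
      algebraMap_mem' := fun r i => (hR i).mem_iff.2 r.2 }
  classical
  -- The ring of functions regular at all `R i` is spanned by `b` over the local ring, hence is a
  -- finite module.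
  refine IsIntegral.of_mem_of_fg A ⟨Finset.univ.image b, le_antisymm ?_ ?_⟩ z hz
  · rw [Submodule.span_le]
    intro x hx
    obtain ⟨i, -, rfl⟩ := Finset.mem_image.1 hx
    exact fun j => (hb i j).mem_ring
  · intro x hx
    have hsum : ∑ i, B.repr x i • b i = x := by
      simpa only [hB] using B.sum_repr x
    have hc := coeff_mem_ring hR hb (a := fun i => B.repr x i) (by rw [hsum]; exact hx)
    rw [← hsum]
    refine Submodule.sum_mem _ fun i _ => ?_
    exact Submodule.smul_mem _ (⟨_, hc i⟩ : P.ring) (Submodule.subset_span (by simp))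

/-- At most `[L : K]` rational places lie over a given place. -/
theorem card_le_finrank [Finite k] [FiniteDimensional K L] {s : Finset (Place k L)}
    (hs : ∀ Q ∈ s, Q.IsRational ∧ Q.LiesOver P) : s.card ≤ Module.finrank K L := by
  classical
  obtain ⟨b, hb⟩ := exists_dual_family (R := fun Q : s => Q.1) (fun Q => (hs _ Q.2).1)
    Subtype.val_injective
  simpa using (linearIndependent_of_dual (fun Q : s => (hs _ Q.2).2) hb).fintype_card_le_finrank

end Place

end Extensions

/-! ### Integral inverses in an order over a local ring. -/

section IntegralInverse

-- Divide a monic equation of degree `n + 1` by `z ^ n`: this expresses `z` as a polynomial in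
-- `z⁻¹`.
open Polynomial in
theorem IsIntegral.mem_subalgebra_of_inv_mem {O L : Type*} [CommRing O] [Field L] [Algebra O L]
    {A : Subalgebra O L} {z : L} (hz : IsIntegral O z) (h : z⁻¹ ∈ A) : z ∈ A := by
  by_cases h0 : z = 0
  · rw [h0]; exact A.zero_mem
  obtain ⟨p, hp, hpz⟩ := hz
  rcases Nat.eq_zero_or_pos p.natDegree with hd | hd
  · have := hp.natDegree_eq_zero.1 hd
    simp [this] at hpz
  obtain ⟨n, hn⟩ : ∃ n, p.natDegree = n + 1 := ⟨p.natDegree - 1, by omega⟩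
  rw [eval₂_eq_sum_range, hn, Finset.sum_range_succ, ← hn, hp.coeff_natDegree, hn, map_one,
    one_mul] at hpz
  have e : z = -∑ i ∈ Finset.range (n + 1), algebraMap O L (p.coeff i) * z⁻¹ ^ (n - i) := by
    have h1 : z = z ^ (n + 1) * z⁻¹ ^ n := by
      rw [inv_pow, pow_succ, mul_right_comm, mul_inv_cancel₀ (pow_ne_zero _ h0), one_mul]
    refine h1.trans ?_
    rw [eq_neg_of_add_eq_zero_right hpz, neg_mul, Finset.sum_mul]
    congr 1
    refine Finset.sum_congr rfl fun i hi => ?_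
    have hi' : i ≤ n := by simpa [Nat.lt_succ_iff] using hi
    rw [mul_assoc]
    congr 1
    obtain ⟨m, rfl⟩ := Nat.exists_eq_add_of_le hi'
    rw [pow_add, ← mul_assoc, ← mul_pow, mul_inv_cancel₀ h0, one_pow, one_mul,
      Nat.add_sub_cancel_left]
  rw [e]
  exact A.neg_mem (A.sum_mem fun i _ => A.mul_mem (A.algebraMap_mem _) (A.pow_mem h _))

/-- If a basis element `ε c` of an order over a local ring is idempotent modulo the maximal ideal,
then `1 - ε c` has no integral inverse. -/
theorem not_isIntegral_inv_one_sub {O L J : Type*} [CommRing O] [IsLocalRing O] [Field L]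
    [Algebra O L] {ε : J → L} (hli : LinearIndependent O ε)
    (hone : (1 : L) ∈ Submodule.span O (Set.range ε))
    (hmul : ∀ c d, ε c * ε d ∈ Submodule.span O (Set.range ε)) {c : J}
    (hidem : ε c - ε c * ε c ∈
      IsLocalRing.maximalIdeal O • Submodule.span O (Set.range ε))
    (hne : 1 - ε c ≠ 0) : ¬ IsIntegral O (1 - ε c)⁻¹ := by
  intro hint
  set N := Submodule.span O (Set.range ε) with hN
  have hmulN : ∀ x y, x ∈ N → y ∈ N → x * y ∈ N := by
    intro x y hx hy
    have h := Submodule.mul_mem_mul hx hy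
    rw [hN, Submodule.span_mul_span] at h
    refine Submodule.span_le.2 ?_ h
    rintro _ ⟨_, ⟨a, rfl⟩, _, ⟨b, rfl⟩, rfl⟩
    exact hmul a b
  have hcN : ε c ∈ N := Submodule.subset_span ⟨c, rfl⟩
  have hinv : (1 - ε c)⁻¹ ∈ N := by
    have := IsIntegral.mem_subalgebra_of_inv_mem (A := N.toSubalgebra hone hmulN) hint
      (by rw [inv_inv]; exact N.sub_mem hone hcN)
    exact this
  have hmem : ε c ∈ IsLocalRing.maximalIdeal O • N := by
    have e : ε c = (ε c - ε c * ε c) * (1 - ε c)⁻¹ := by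
      field_simp
    rw [e]
    refine Submodule.smul_induction_on hidem (fun r hr n hn => ?_) fun x y hx hy => ?_
    · rw [smul_mul_assoc]
      exact Submodule.smul_mem_smul hr (hmulN _ _ hn hinv)
    · rw [add_mul]
      exact Submodule.add_mem _ hx hy
  rw [hN, Submodule.mem_ideal_smul_span_iff_exists_sum] at hmem
  obtain ⟨a, ha, hsum⟩ := hmem
  -- By independence the coefficient of `ε c` in its own expansion is `1`, which would have to lie
  -- in the maximal ideal.
  have h1 : a = Finsupp.single c 1 := hli (by
    simpa [Finsupp.linearCombination_apply] using hsum)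
  have := ha c
  rw [h1, Finsupp.single_eq_same] at this
  exact (IsLocalRing.maximalIdeal.isMaximal O).ne_top ((Ideal.eq_top_iff_one _).2 this)

end IntegralInverse

/-! ### Products of Reed–Solomon codes on a grid. -/

section GridCodes

open Polynomial Function

variable {k ι : Type*} [Field k] [Fintype ι]

/-- The functions on `k ^ ι` given by polynomials of degree at most `m i` in the variable `i`. -/
def boundedPolynomialFunctions (k : Type*) [Field k] (m : ι → ℕ) : Submodule k ((ι → k) → k) :=
  Submodule.span k {p | ∃ e : ι → ℕ, (∀ i, e i ≤ m i) ∧ p = fun x => ∏ i, x i ^ e i}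

theorem exists_polynomial_update [DecidableEq ι] {m : ι → ℕ} {p : (ι → k) → k}
    (hp : p ∈ boundedPolynomialFunctions k m) (i : ι) (x : ι → k) :
    ∃ q : k[X], q.natDegree ≤ m i ∧ ∀ a, p (update x i a) = q.eval a := by
  induction hp using Submodule.span_induction with
  | mem p hp =>
    obtain ⟨e, he, rfl⟩ := hp
    refine ⟨C (∏ l ∈ Finset.univ.erase i, x l ^ e l) * X ^ e i,
      (natDegree_C_mul_X_pow_le _ _).trans (he i), fun a => ?_⟩
    beta_reduce
    rw [← Finset.mul_prod_erase _ _ (Finset.mem_univ i), update_self, eval_mul, eval_C, eval_pow,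
      eval_X, mul_comm]
    congr 1
    refine Finset.prod_congr rfl fun l hl => ?_
    rw [update_of_ne (Finset.ne_of_mem_erase hl)]
  | zero => exact ⟨0, by simp, by simp⟩
  | add p p' _ _ h h' =>
    obtain ⟨q, hq, hpq⟩ := h
    obtain ⟨q', hq', hpq'⟩ := h'
    exact ⟨q + q', (natDegree_add_le _ _).trans (max_le hq hq'), fun a => by simp [hpq, hpq']⟩
  | smul c p _ h =>
    obtain ⟨q, hq, hpq⟩ := h
    exact ⟨c • q, (natDegree_smul_le _ _).trans hq, fun a => by simp [hpq]⟩

/-- The minimum distance of a product of Reed–Solomon codes. -/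
theorem prod_le_card_nonzeros [DecidableEq ι] [DecidableEq k] {m : ι → ℕ} {p : (ι → k) → k}
    (hp : p ∈ boundedPolynomialFunctions k m) (G : ι → Finset k) (s : Finset ι) (x : ι → k)
    (hx : ∀ i, x i ∈ G i) (hpx : p x ≠ 0) :
    ∏ i ∈ s, ((G i).card - m i) ≤
      ((Fintype.piFinset G).filter fun z => (∀ i ∉ s, z i = x i) ∧ p z ≠ 0).card := by
  induction s using Finset.induction_on generalizing x with
  | empty =>
    rw [Finset.prod_empty, Finset.one_le_card]
    exact ⟨x, by simp [hx, hpx]⟩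
  | insert j s hj ih =>
    obtain ⟨q, hq, hpq⟩ := exists_polynomial_update hp j x
    have hq0 : q ≠ 0 := by
      rintro rfl
      have := hpq (x j)
      rw [update_eq_self] at this
      exact hpx (by simpa using this)
    set T := (G j).filter fun a => p (update x j a) ≠ 0 with hT
    -- On the line through `x` in direction `j`, `p` is a nonzero polynomial of degree at most `m
    -- j`. Each of its nonzeros starts a slice to which induction applies, and slices with different
    -- `j`-th coordinate are disjoint.
    have hTcard : (G j).card - m j ≤ T.card := by
      have h1 := Finset.card_filter_add_card_filter_not (s := G j) fun a => p (update x j a) ≠ 0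
      have h2 : ((G j).filter fun a => ¬ p (update x j a) ≠ 0).card ≤ m j := by
        refine (card_le_degree_of_subset_roots (p := q) fun a ha => ?_).trans hq
        rw [Finset.mem_val, Finset.mem_filter, not_not, hpq] at ha
        exact (mem_roots hq0).2 ha.2
      rw [← hT] at h1
      omega
    rw [Finset.prod_insert hj]
    calc _ ≤ T.card * ∏ i ∈ s, ((G i).card - m i) := Nat.mul_le_mul_right _ hTcard
      _ = ∑ a ∈ T, ∏ i ∈ s, ((G i).card - m i) := by rw [Finset.sum_const, smul_eq_mul]
      _ ≤ ∑ a ∈ T, ((Fintype.piFinset G).filter fun z =>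
            (∀ i ∉ s, z i = update x j a i) ∧ p z ≠ 0).card := by
          refine Finset.sum_le_sum fun a ha => ih _ (fun i => ?_) (Finset.mem_filter.1 ha).2
          rcases eq_or_ne i j with rfl | hij
          · simpa using (Finset.mem_filter.1 ha).1
          · simpa [hij] using hx i
      _ = (T.biUnion fun a => (Fintype.piFinset G).filter fun z =>
            (∀ i ∉ s, z i = update x j a i) ∧ p z ≠ 0).card := by
          rw [Finset.card_biUnion]
          intro a _ b _ hab
          refine Finset.disjoint_left.2 fun z hz hz' => ?_
          have h1 := (Finset.mem_filter.1 hz).2.1 j hj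
          have h2 := (Finset.mem_filter.1 hz').2.1 j hj
          rw [update_self] at h1 h2
          exact hab (h1.symm.trans h2)
      _ ≤ _ := by
          refine Finset.card_le_card fun z hz => ?_
          obtain ⟨a, -, hz⟩ := Finset.mem_biUnion.1 hz
          obtain ⟨hzG, hzx, hz0⟩ := Finset.mem_filter.1 hz
          refine Finset.mem_filter.2 ⟨hzG, fun i hi => ?_, hz0⟩
          rw [Finset.mem_insert, not_or] at hi
          rw [hzx i hi.2, update_of_ne hi.1]

/-- The coordinates outside `s` are constant, so every monomial is a scalar multiple of one in the
variables of `s` alone. -/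
theorem finrank_map_boundedPolynomialFunctions_le {T : Type*} {m : ι → ℕ} (v : T → ι → k)
    (s : Finset ι) (x : ι → k) (hv : ∀ τ, ∀ i ∉ s, v τ i = x i)
    {C : Submodule k (T → k)}
    (hC : C ≤ (boundedPolynomialFunctions k m).map (LinearMap.funLeft k k v)) :
    Module.finrank k C ≤ ∏ i ∈ s, (m i + 1) := by
  classical
  let M : (∀ i : s, Fin (m i + 1)) → T → k := fun e τ => ∏ i : s, v τ i ^ (e i : ℕ)
  have hle : C ≤ Submodule.span k (Set.range M) := by
    refine hC.trans ?_
    rw [boundedPolynomialFunctions, Submodule.map_span, Submodule.span_le]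
    rintro _ ⟨_, ⟨e, he, rfl⟩, rfl⟩
    have e1 : LinearMap.funLeft k k v (fun x => ∏ i, x i ^ e i) =
        (∏ i ∈ sᶜ, x i ^ e i) • M fun i => ⟨e i, Nat.lt_succ_of_le (he i)⟩ := by
      funext τ
      rw [LinearMap.funLeft_apply, ← Finset.prod_mul_prod_compl s, mul_comm, Pi.smul_apply,
        smul_eq_mul]
      congr 1
      · exact Finset.prod_congr rfl fun i hi => by rw [hv τ i (Finset.mem_compl.1 hi)]
      · exact (Finset.prod_coe_sort s fun i => v τ i ^ e i).symm
    rw [e1]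
    exact Submodule.smul_mem _ _ (Submodule.subset_span ⟨_, rfl⟩)
  have : FiniteDimensional k (Submodule.span k (Set.range M)) :=
    FiniteDimensional.span_of_finite k (Set.finite_range M)
  refine (Submodule.finrank_mono hle).trans ((finrank_range_le_card M).trans ?_)
  rw [Fintype.card_pi, ← Finset.prod_coe_sort s]
  simp

end GridCodes

/-! ### Degrees and generators of composita. -/

section Composita

variable {K L : Type*} [Field K] [Field L] [Algebra K L] {t : ℕ} {E : Fin t → IntermediateField K L}

theorem LinearlyDisjointFamily.finrank_iSup (h : LinearlyDisjointFamily E) (s : Finset (Fin t)) :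
    Module.finrank K (⨆ i ∈ s, E i : IntermediateField K L) =
      ∏ i ∈ s, Module.finrank K (E i) := by
  induction s using Finset.induction_on with
  | empty => simp
  | insert j s hj ih =>
    have hle : (⨆ i ∈ s, E i) ≤ partialCompositum E {j} :=
      iSup₂_le fun i hi => le_iSup₂_of_le i
        (fun hij => hj (by rwa [← Set.mem_singleton_iff.1 hij])) le_rfl
    rw [Finset.iSup_insert, ((h j).of_le_right hle).finrank_sup, ih, Finset.prod_insert hj]

theorem LinearlyDisjointFamily.finrank_partialCompositum (h : LinearlyDisjointFamily E)
    (A : Finset (Fin t)) :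
    Module.finrank K (partialCompositum E (A : Set (Fin t))) =
      ∏ i ∈ Aᶜ, Module.finrank K (E i) := by
  have e : partialCompositum E (A : Set (Fin t)) = ⨆ i ∈ Aᶜ, E i := by
    simp [partialCompositum]
  rw [e, h.finrank_iSup]

theorem LinearlyDisjointFamily.finrank_eq_prod (h : LinearlyDisjointFamily E)
    (hX : ⨆ j, E j = ⊤) : Module.finrank K L = ∏ i, Module.finrank K (E i) := by
  have e : (⨆ i ∈ (Finset.univ : Finset (Fin t)), E i) = ⊤ := by simpa using hX
  rw [← h.finrank_iSup, e, IntermediateField.finrank_top']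

theorem LinearlyDisjointFamily.finrank_partialCompositum_left (h : LinearlyDisjointFamily E)
    (hX : ⨆ j, E j = ⊤) (hpos : ∀ j, 0 < Module.finrank K (E j)) (A : Finset (Fin t)) :
    Module.finrank (partialCompositum E (A : Set (Fin t))) L =
      ∏ i ∈ A, Module.finrank K (E i) := by
  have h1 := Module.finrank_mul_finrank K (partialCompositum E (A : Set (Fin t))) L
  rw [h.finrank_partialCompositum, h.finrank_eq_prod hX, ← Finset.prod_compl_mul_prod A] at h1
  exact Nat.eq_of_mul_eq_mul_left (Finset.prod_pos fun i _ => hpos i) h1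

/-- The span is closed under products, and a subalgebra of an algebraic extension is a field, here
one containing every `E j`. -/
theorem span_prod_eq_top [FiniteDimensional K L] (hX : ⨆ j, E j = ⊤) :
    Submodule.span K {z : L | ∃ x : ∀ j, E j, z = ∏ j, (x j : L)} = ⊤ := by
  classical
  set N := Submodule.span K {z : L | ∃ x : ∀ j, E j, z = ∏ j, (x j : L)} with hN
  have hone : (1 : L) ∈ N := Submodule.subset_span ⟨fun _ => 1, by simp⟩
  have hmul : ∀ x y, x ∈ N → y ∈ N → x * y ∈ N := by
    intro x y hx hy
    have h := Submodule.mul_mem_mul hx hy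
    rw [hN, Submodule.span_mul_span] at h
    refine Submodule.span_mono ?_ h
    rintro _ ⟨_, ⟨a, rfl⟩, _, ⟨b, rfl⟩, rfl⟩
    exact ⟨a * b, by simp [Finset.prod_mul_distrib]⟩
  have hle : ∀ j, (E j).toSubalgebra ≤ N.toSubalgebra hone hmul := by
    intro j z hz
    refine Submodule.subset_span ⟨Function.update 1 j ⟨z, hz⟩, ?_⟩
    rw [← Finset.mul_prod_erase _ _ (Finset.mem_univ j), Function.update_self,
      Finset.prod_eq_one, mul_one]
    intro i hi
    rw [Function.update_of_ne (Finset.ne_of_mem_erase hi)]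
    rfl
  let N' : IntermediateField K L := (N.toSubalgebra hone hmul).toIntermediateField
    fun x hx => (Algebra.IsIntegral.isIntegral x).inv_mem hx
  have htop : (⊤ : IntermediateField K L) ≤ N' := hX ▸ iSup_le hle
  exact eq_top_iff.2 fun z _ => htop (IntermediateField.mem_top (x := z))

end Composita

/-! ### Completely split places in intermediate fields. -/

section SplitPlaces

namespace Place

variable {k F : Type*} [Field k] [Field F] [Algebra k F]

theorem HasValue.sum {P : Place k F} {ι : Type*} {s : Finset ι} {f : ι → F} {a : ι → k}
    (h : ∀ i ∈ s, P.HasValue (f i) (a i)) : P.HasValue (∑ i ∈ s, f i) (∑ i ∈ s, a i) := by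
  classical
  induction s using Finset.induction_on with
  | empty => simpa using HasValue.zero P
  | insert i s hi ih =>
    rw [Finset.sum_insert hi, Finset.sum_insert hi]
    exact (h i (by simp)).add (ih fun j hj => h j (by simp [hj]))

variable {K L : Type*} [Field K] [Field L] [Algebra k K] [Algebra k L] [Algebra K L]
  [IsScalarTower k K L] {P : Place k K} {Q Q' : Place k L}

/-- Subtracting the constants `c j` from the coefficients reduces this to `coeff_mem_nonunits`. -/
theorem hasValue_coeff {ι : Type*} [Fintype ι] [DecidableEq ι] {R : ι → Place k L} {b : ι → L}
    (hR : ∀ i, (R i).LiesOver P) (hb : ∀ i j, (R j).HasValue (b i) (if i = j then 1 else 0))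
    {a : ι → K} {c : ι → k} (h : ∀ i, (R i).HasValue (∑ j, a j • b j) (c i)) (i : ι) :
    P.HasValue (a i) (c i) := by
  refine coeff_mem_nonunits hR hb (a := fun j => a j - algebraMap k K (c j)) (fun l => ?_) i
  have h1 : (R l).HasValue (∑ j, c j • b j) (∑ j, c j * if j = l then 1 else 0) :=
    HasValue.sum fun j _ => (hb j l).smul (c j)
  have h2 := (h l).sub h1
  rw [← hasValue_zero_iff]
  simpa [sub_smul, Finset.sum_sub_distrib, algebraMap_smul] using h2

instance isScalarTower_intermediateField (M : IntermediateField K L) : IsScalarTower k M L :=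
  IsScalarTower.of_algebraMap_eq fun _ => rfl

/-- The image of `Q` on the curve with function field `M`. -/
def LiesOver.restrict (h : Q.LiesOver P) (M : IntermediateField K L) : Place k M where
  ring := Q.ring.comap (algebraMap M L)
  algebraMap_mem c := by
    rw [ValuationSubring.mem_comap, ← IsScalarTower.algebraMap_apply]
    exact Q.algebraMap_mem c
  ne_top htop := P.ne_top (by
    refine eq_top_iff.2 fun x _ => ?_
    have : algebraMap K M x ∈ Q.ring.comap (algebraMap M L) := htop ▸ ValuationSubring.mem_top _
    rw [ValuationSubring.mem_comap, ← IsScalarTower.algebraMap_apply] at this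
    exact h.mem_iff.1 this)

theorem LiesOver.liesOver_restrict (h : Q.LiesOver P) (M : IntermediateField K L) :
    Q.LiesOver (h.restrict M) := rfl

theorem LiesOver.restrict_liesOver (h : Q.LiesOver P) (M : IntermediateField K L) :
    (h.restrict M).LiesOver P := by
  refine ValuationSubring.ext _ _ fun x => ?_
  rw [← h.mem_iff, IsScalarTower.algebraMap_apply K M L]
  rfl

theorem LiesOver.restrict_eq_iff (h : Q.LiesOver P) (h' : Q'.LiesOver P)
    (M : IntermediateField K L) : h.restrict M = h'.restrict M ↔ SameImage M Q Q' :=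
  ⟨fun e => congrArg Place.ring e, fun e => ext_ring e⟩

variable (L) in
/-- The rational points of the curve with function field `L` over the point `P`. -/
def rationalFiber (P : Place k K) : Set (Place k L) := {Q | Q.IsRational ∧ Q.LiesOver P}

variable [Finite k] [FiniteDimensional K L]

/-- If `P` splits completely in `L`, then it splits completely in every intermediate field `M`,
and so does every point over `P` in the extension `L / M`. -/
theorem card_image_restrict_and_fiber [Fintype (rationalFiber L P)]
    [DecidableEq (Place k L)]
    (hP : Fintype.card (rationalFiber L P) = Module.finrank K L) (M : IntermediateField K L)
    [DecidableEq (Place k M)] :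
    (Finset.univ.image fun Q : rationalFiber L P => Q.2.2.restrict M).card = Module.finrank K M ∧
      ∀ Q : rationalFiber L P, (Finset.univ.filter fun Q' : rationalFiber L P =>
        Q'.2.2.restrict M = Q.2.2.restrict M).card = Module.finrank M L := by
  set r := fun Q : rationalFiber L P => Q.2.2.restrict M with hr
  set I := Finset.univ.image r with hI
  have hIle : I.card ≤ Module.finrank K M := by
    refine card_le_finrank (P := P) fun R hR => ?_
    obtain ⟨Q, -, rfl⟩ := Finset.mem_image.1 hR
    exact ⟨(Q.2.2.liesOver_restrict M).isRational Q.2.1, Q.2.2.restrict_liesOver M⟩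
  have hfib : ∀ R ∈ I, (Finset.univ.filter fun Q' => r Q' = R).card ≤ Module.finrank M L := by
    intro R _
    rw [← Finset.card_image_of_injective _ Subtype.val_injective]
    refine card_le_finrank (P := R) fun Q hQ => ?_
    obtain ⟨Q, hQR, rfl⟩ := Finset.mem_image.1 hQ
    refine ⟨Q.2.1, ?_⟩
    rw [← (Finset.mem_filter.1 hQR).2]
    exact Q.2.2.liesOver_restrict M
  have hsum : ∑ R ∈ I, (Finset.univ.filter fun Q' => r Q' = R).card = Module.finrank K L := by
    rw [← hP, ← Finset.card_univ]
    exact (Finset.card_eq_sum_card_image r Finset.univ).symm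
  have htower := Module.finrank_mul_finrank K M L
  -- At most `[M : K]` images with at most `[L : M]` points above each must account for `[L : K]`
  -- points, so both bounds are attained.
  have hpos : 0 < Module.finrank M L := Module.finrank_pos
  have hle := Finset.sum_le_sum hfib
  rw [Finset.sum_const, smul_eq_mul] at hle
  have hcard : I.card = Module.finrank K M := by
    refine le_antisymm hIle (Nat.le_of_mul_le_mul_right ?_ hpos)
    rwa [htower, ← hsum]
  refine ⟨hcard, fun Q => ?_⟩
  refine (Finset.sum_eq_sum_iff_of_le hfib).1 ?_ (r Q)
    (Finset.mem_image_of_mem r (Finset.mem_univ Q))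
  rw [Finset.sum_const, smul_eq_mul, hcard, htower, hsum]

end Place

end SplitPlaces

/-! ### The fiber over a split point is a grid. -/

section Coordinates

open Place

variable {k K L : Type*} [Field k] [Field K] [Field L] [Algebra k K] [Algebra k L] [Algebra K L]
  [IsScalarTower k K L] {t : ℕ} {E : Fin t → IntermediateField K L} {P : Place k K}

theorem card_image_le_of_factorsThrough {α β γ : Type*} [Fintype α] [DecidableEq β] [DecidableEq γ]
    {f : α → β} {g : α → γ} (h : ∀ a b, f a = f b → g a = g b) :
    (Finset.univ.image g).card ≤ (Finset.univ.image f).card := by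
  cases isEmpty_or_nonempty α
  · simp
  have : Nonempty γ := ⟨g (Classical.arbitrary α)⟩
  have e : g = Function.extend f g (fun _ => Classical.arbitrary γ) ∘ f :=
    funext fun a => (Function.FactorsThrough.extend_apply (fun a b => h a b) _ a).symm
  rw [e, ← Finset.image_image]
  exact Finset.card_image_le

theorem prod_sum_smul_eq {J : Fin t → Type*} [∀ j, Fintype (J j)] (b : ∀ j, J j → E j)
    (a : ∀ j, J j → K) :
    ∏ j, ((∑ f, a j f • b j f : E j) : L) =
      ∑ x : ∀ j, J j, (∏ j, a j (x j)) • ∏ j, (b j (x j) : L) := by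
  classical
  have h : ∀ j, ((∑ f, a j f • b j f : E j) : L) = ∑ f, a j f • (b j f : L) := fun j => by
    simp
  simp_rw [h]
  rw [Finset.prod_univ_sum, Fintype.piFinset_univ]
  refine Finset.sum_congr rfl fun x _ => ?_
  simp_rw [Algebra.smul_def]
  rw [Finset.prod_mul_distrib, map_prod]

/-- If `b j` is dual to the points `R j` of `𝒴_j` over `P`, then no product of the `b j (x j)`
vanishes at all points of `𝒳` over `P`. -/
theorem exists_hasValue_prod_ne_zero [Finite k] [FiniteDimensional K L]
    (hX : ⨆ j, E j = ⊤) (hLcard : Module.finrank K L = ∏ i, Module.finrank K (E i))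
    {ι : Type*} [Fintype ι] [DecidableEq ι] {Q : ι → Place k L}
    (hQrat : ∀ i, (Q i).IsRational) (hQinj : Function.Injective Q) (hQ : ∀ i, (Q i).LiesOver P)
    (hQcard : Fintype.card ι = Module.finrank K L)
    {J : Fin t → Type*} [∀ j, Fintype (J j)] [∀ j, DecidableEq (J j)]
    {R : ∀ j, J j → Place k (E j)} (hR : ∀ j c, (R j c).LiesOver P)
    (hJ : ∀ j, Fintype.card (J j) = Module.finrank K (E j)) {b : ∀ j, J j → E j}
    (hb : ∀ j c d, (R j d).HasValue (b j c) (if c = d then 1 else 0)) (x : ∀ j, J j) :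
    ∃ i, ¬ (Q i).HasValue (∏ j, (b j (x j) : L)) 0 := by
  classical
  have hne : ∀ j, Nonempty (J j) := fun j => ⟨x j⟩
  have hbli := fun j => linearIndependent_of_dual (hR j) (hb j)
  let B := fun j => basisOfLinearIndependentOfCardEqFinrank (hbli j) (hJ j)
  have hB : ∀ j z, ∑ c, (B j).repr z c • b j c = z := fun j z => by
    simpa [B] using (B j).sum_repr z
  have hcoeff : ∀ j (z : E j) (c : J j → k), (∀ d, (R j d).HasValue z (c d)) →
      ∀ d, P.HasValue ((B j).repr z d) (c d) := fun j z c h =>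
    hasValue_coeff (hR j) (hb j) (by rw [hB]; exact h)
  let ε : (∀ j, J j) → L := fun x => ∏ j, (b j (x j) : L)
  have hexp : ∀ z : ∀ j, E j,
      ∏ j, (z j : L) = ∑ x : ∀ j, J j, (∏ j, (B j).repr (z j) (x j)) • ε x := fun z => by
    rw [← prod_sum_smul_eq]
    exact Finset.prod_congr rfl fun j _ => by rw [hB]
  have hspan : ⊤ ≤ Submodule.span K (Set.range ε) := by
    rw [← span_prod_eq_top hX, Submodule.span_le]
    rintro _ ⟨z, rfl⟩
    rw [hexp]
    exact Submodule.sum_mem _ fun x _ => Submodule.smul_mem _ _ (Submodule.subset_span ⟨x, rfl⟩)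
  -- The `ε x` span `L` and there are `[L : K]` of them, so they are independent over `K`, and hence
  -- over the local ring.
  have hli : LinearIndependent P.ring ε := by
    refine LinearIndependent.restrict_scalars (K := K) ?_
      (linearIndependent_of_top_le_span_of_card_eq_finrank hspan ?_)
    · intro r s hrs
      exact Subtype.ext (by simpa [Algebra.smul_def] using hrs)
    · rw [Fintype.card_pi, hLcard]
      exact Finset.prod_congr rfl fun j _ => hJ j
  have hval : ∀ (z : ∀ j, E j) (c : ∀ j, J j → k), (∀ j d, (R j d).HasValue (z j) (c j d)) →
      ∀ f : ∀ j, J j, P.HasValue (∏ j, (B j).repr (z j) (f j)) (∏ j, c j (f j)) := fun z c h f =>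
    HasValue.prod fun j _ => hcoeff j _ _ (h j) _
  have hmemspan : ∀ (z : ∀ j, E j) (c : ∀ j, J j → k), (∀ j d, (R j d).HasValue (z j) (c j d)) →
      ∏ j, (z j : L) ∈ Submodule.span P.ring (Set.range ε) := by
    intro z c h
    rw [hexp]
    refine Submodule.sum_mem _ fun f _ => ?_
    exact Submodule.smul_mem _ (⟨_, (hval z c h f).mem_ring⟩ : P.ring)
      (Submodule.subset_span ⟨f, rfl⟩)
  have hone : (1 : L) ∈ Submodule.span P.ring (Set.range ε) := by
    simpa using hmemspan 1 1 fun j d => (R j d).hasValue_one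
  have hmul : ∀ c d, ε c * ε d ∈ Submodule.span P.ring (Set.range ε) := by
    intro c d
    have := hmemspan (fun j => b j (c j) * b j (d j)) _
      fun j f => (hb j (c j) f).mul (hb j (d j) f)
    simpa [ε, Finset.prod_mul_distrib] using this
  have hidem : ε x - ε x * ε x ∈
      IsLocalRing.maximalIdeal P.ring • Submodule.span P.ring (Set.range ε) := by
    have h1 : ε x * ε x = ∑ f : ∀ j, J j,
        (∏ j, (B j).repr (b j (x j) * b j (x j)) (f j)) • ε f := by
      rw [← hexp]
      simp [ε, Finset.prod_mul_distrib]
    have h2 : ε x = ∑ f : ∀ j, J j, (if x = f then (1 : K) else 0) • ε f := by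
      simp
    -- The coefficients of `b j (x j) ^ 2` have values `0` or `1`, the same as those of `b j (x j)`;
    -- so `ε x` and `ε x * ε x` have coefficients with equal values at `P`.
    have h3 : ∀ f, (if x = f then (1 : K) else 0) -
        ∏ j, (B j).repr (b j (x j) * b j (x j)) (f j) ∈ P.ring.nonunits := by
      intro f
      have ha := hval (fun j => b j (x j) * b j (x j)) _
        (fun j f => (hb j (x j) f).mul (hb j (x j) f)) f
      have hc : (∏ j, ((if x j = f j then (1 : k) else 0) * if x j = f j then (1 : k) else 0)) =
          if x = f then 1 else 0 := by
        split_ifs with hxf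
        · simp [hxf]
        · obtain ⟨j, hj⟩ := Function.ne_iff.1 hxf
          exact Finset.prod_eq_zero (Finset.mem_univ j) (by simp [hj])
      rw [hc] at ha
      have hd : P.HasValue (if x = f then (1 : K) else 0) (if x = f then 1 else 0) := by
        split_ifs
        · exact P.hasValue_one
        · exact HasValue.zero P
      have := hd.sub ha
      rwa [sub_self, hasValue_zero_iff] at this
    rw [h1]
    nth_rewrite 1 [h2]
    rw [← Finset.sum_sub_distrib]
    refine Submodule.sum_mem _ fun f _ => ?_
    rw [← sub_smul]
    refine Submodule.smul_mem_smul (r := (⟨_, P.ring.nonunits_subset (h3 f)⟩ : P.ring)) ?_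
      (Submodule.subset_span ⟨f, rfl⟩)
    exact ValuationSubring.coe_mem_nonunits_iff.1 (h3 f)
  by_contra! hzero
  have hι : Nonempty ι := Fintype.card_pos_iff.1 (hQcard ▸ Module.finrank_pos)
  have hone_sub : ∀ i, (Q i).HasValue (1 - ε x) 1 := fun i => by
    simpa using (Q i).hasValue_one.sub (hzero i)
  have hne0 : 1 - ε x ≠ 0 := by
    intro h0
    have := hone_sub hι.some
    rw [h0] at this
    exact zero_ne_one ((HasValue.zero _).unique this)
  refine not_isIntegral_inv_one_sub hli hone hmul hidem hne0
    (isIntegral_of_forall_mem hQrat hQinj hQ hQcard fun i => ?_)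
  exact ((hone_sub i).inv one_ne_zero).mem_ring

end Coordinates

section Coordinates

open Place

variable {k K L : Type*} [Field k] [Field K] [Field L] [Algebra k K] [Algebra k L] [Algebra K L]
  [IsScalarTower k K L] {t : ℕ} {E : Fin t → IntermediateField K L} {P : Place k K}

/-- The values of the `y j` identify the fiber over a completely split point with a grid, and the
map to a partial fiber product with a coordinate projection of that grid. -/
theorem exists_coordinates [Finite k] (hdisj : LinearlyDisjointFamily E) (hX : ⨆ j, E j = ⊤)
    (hpos : ∀ j, 0 < Module.finrank K (E j)) (y : ∀ j, E j)
    (hsplit : (rationalFiber L P).encard = (Module.finrank K L : ℕ∞))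
    (hpole : ∀ Q ∈ rationalFiber L P, ∀ j, (y j : L) ∈ Q.ring)
    (hinj : ∀ j, ∀ R R' : Place k (E j), R.IsRational → R'.IsRational →
      R.LiesOver P → R'.LiesOver P → ∀ c : k, R.HasValue (y j) c → R'.HasValue (y j) c → R = R') :
    ∃ (v : rationalFiber L P → Fin t → k) (G : Fin t → Finset k),
      (∀ (Q : rationalFiber L P) j, Q.1.HasValue (y j : L) (v Q j)) ∧ (∀ j, (G j).card = Module.finrank K (E j)) ∧
      Function.Injective v ∧ (∀ x, (∃ Q, v Q = x) ↔ ∀ j, x j ∈ G j) ∧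
      (∀ (A : Finset (Fin t)) (Q Q' : rationalFiber L P),
        SameImage (partialCompositum E (A : Set (Fin t))) Q.1 Q'.1 ↔ ∀ i ∉ A, v Q' i = v Q i) ∧
      ∀ (A : Finset (Fin t)) (Q : rationalFiber L P),
        {Q' : rationalFiber L P |
          SameImage (partialCompositum E (A : Set (Fin t))) Q.1 Q'.1}.encard =
          ((∏ i ∈ A, Module.finrank K (E i) : ℕ) : ℕ∞) := by
  classical
  have hLcard := hdisj.finrank_eq_prod hX
  have hLpos : 0 < Module.finrank K L := hLcard ▸ Finset.prod_pos fun i _ => hpos i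
  have : FiniteDimensional K L := FiniteDimensional.of_finrank_pos hLpos
  have hfin : (rationalFiber L P).Finite := Set.finite_of_encard_eq_coe hsplit
  let _ : Fintype (rationalFiber L P) := hfin.fintype
  have hT : Fintype.card (rationalFiber L P) = Module.finrank K L := by
    rw [← Set.toFinset_card, ← ENat.natCast_inj, ← hsplit, Set.encard_eq_coe_toFinset_card]
  have hval : ∀ (Q : rationalFiber L P) j, ∃ c, Q.1.HasValue (y j : L) c :=
    fun Q j => Q.2.1 _ (hpole _ Q.2 j)
  choose v hv using hval
  have hres : ∀ (Q : rationalFiber L P) j, (Q.2.2.restrict (E j)).HasValue (y j) (v Q j) :=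
    fun Q j => (Q.2.2.liesOver_restrict (E j)).hasValue_iff.1 (hv Q j)
  have hresrat : ∀ (Q : rationalFiber L P) j, (Q.2.2.restrict (E j)).IsRational :=
    fun Q j => (Q.2.2.liesOver_restrict (E j)).isRational Q.2.1
  have hker : ∀ j (Q Q' : rationalFiber L P),
      v Q j = v Q' j ↔ Q.2.2.restrict (E j) = Q'.2.2.restrict (E j) := by
    refine fun j Q Q' => ⟨fun h => ?_, fun h => ?_⟩
    · exact hinj j _ _ (hresrat Q j) (hresrat Q' j) (Q.2.2.restrict_liesOver _)
        (Q'.2.2.restrict_liesOver _) (v Q j) (hres Q j) (h ▸ hres Q' j)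
    · exact (hres Q j).unique (h ▸ hres Q' j)
  let G : Fin t → Finset k := fun j => Finset.univ.image fun Q => v Q j
  -- By injectivity of `y j` on points, its values correspond to the images of the fiber on `𝒴_j`,
  -- which number `[E j : K]`.
  have hG : ∀ j, (G j).card = Module.finrank K (E j) := fun j => by
    rw [← (card_image_restrict_and_fiber hT (E j)).1]
    exact le_antisymm (card_image_le_of_factorsThrough fun Q Q' h => (hker j Q Q').2 h)
      (card_image_le_of_factorsThrough fun Q Q' h => (hker j Q Q').1 h)
  have hvG : ∀ Q j, v Q j ∈ G j := fun Q j => Finset.mem_image_of_mem _ (Finset.mem_univ Q)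
  have hsurj : ∀ x : ∀ j, G j, ∃ Q, ∀ j, v Q j = x j := by
    have hq : ∀ j (c : G j), ∃ Q, v Q j = c := fun j c => by
      obtain ⟨Q, -, h⟩ := Finset.mem_image.1 c.2
      exact ⟨Q, h⟩
    choose q hq using hq
    have hdual := fun j => exists_dual_family
      (R := fun c : G j => (q j c).2.2.restrict (E j)) (fun c => hresrat _ j) fun c d h =>
        Subtype.ext (by rw [← hq j c, ← hq j d]; exact (hker j _ _).2 h)
    choose b hb using hdual
    intro x
    obtain ⟨Q, hQ⟩ := exists_hasValue_prod_ne_zero hX hLcard (Q := fun Q : rationalFiber L P => Q.1)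
      (fun Q => Q.2.1) Subtype.val_injective (fun Q => Q.2.2) hT
      (fun j c => (q j c).2.2.restrict_liesOver (E j)) (fun j => by simpa using hG j) hb x
    refine ⟨Q, fun j => ?_⟩
    by_contra hj
    -- At `Q` the function `b i (x i)` is the indicator of `x i = v Q i`, so one wrong coordinate
    -- would make the product vanish at `Q`.
    have hbQ : ∀ i, Q.1.HasValue (b i (x i) : L) (if x i = ⟨v Q i, hvG Q i⟩ then 1 else 0) := by
      intro i
      have h1 := hb i (x i) ⟨v Q i, hvG Q i⟩
      rw [(hker i _ Q).1 (hq i _)] at h1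
      exact (Q.2.2.liesOver_restrict (E i)).hasValue_iff.2 h1
    have hprod := HasValue.prod (s := Finset.univ) fun i _ => hbQ i
    have hxj : x j ≠ ⟨v Q j, hvG Q j⟩ := fun h => hj (by rw [h])
    have hzero := Finset.prod_eq_zero (f := fun i =>
      if x i = ⟨v Q i, hvG Q i⟩ then (1 : k) else 0) (Finset.mem_univ j) (if_neg hxj)
    rw [hzero] at hprod
    exact hQ hprod
  let w : rationalFiber L P → ∀ j, G j := fun Q j => ⟨v Q j, hvG Q j⟩
  have hw : Function.Bijective w := by
    rw [Fintype.bijective_iff_surjective_and_card]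
    refine ⟨fun x => ?_, ?_⟩
    · obtain ⟨Q, hQ⟩ := hsurj x
      exact ⟨Q, funext fun j => Subtype.ext (hQ j)⟩
    · rw [hT, hLcard, Fintype.card_pi]
      exact Finset.prod_congr rfl fun j _ => by simp [hG]
  have hvinj : Function.Injective v := fun Q Q' h =>
    hw.1 (funext fun j => Subtype.ext (congrFun h j))
  have hcount : ∀ (A : Finset (Fin t)) (Q : rationalFiber L P),
      (Finset.univ.filter fun Q' : rationalFiber L P =>
        SameImage (partialCompositum E (A : Set (Fin t))) Q.1 Q'.1).card =
        ∏ i ∈ A, Module.finrank K (E i) := by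
    intro A Q
    rw [← hdisj.finrank_partialCompositum_left hX hpos,
      ← (card_image_restrict_and_fiber hT (partialCompositum E (A : Set (Fin t)))).2 Q]
    congr 1
    refine Finset.filter_congr fun Q' _ => ?_
    rw [LiesOver.restrict_eq_iff]
    exact eq_comm
  refine ⟨v, G, hv, hG, hvinj, fun x => ⟨?_, fun hx => ?_⟩, fun A Q Q' => ?_, fun A Q => ?_⟩
  · rintro ⟨Q, rfl⟩
    exact hvG Q
  · obtain ⟨Q, hQ⟩ := hsurj fun j => ⟨x j, hx j⟩
    exact ⟨Q, funext hQ⟩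
  · have hsub : (Finset.univ.filter fun Q' : rationalFiber L P =>
        SameImage (partialCompositum E (A : Set (Fin t))) Q.1 Q'.1) ⊆
        Finset.univ.filter fun Q' => ∀ i ∉ A, v Q' i = v Q i := by
      intro Q' hQ'
      refine Finset.mem_filter.2 ⟨Finset.mem_univ _, fun i hi => ?_⟩
      have hle : E i ≤ partialCompositum E (A : Set (Fin t)) :=
        le_iSup₂_of_le (f := fun i (_ : i ∈ (A : Set (Fin t))ᶜ) => E i) i (by simpa using hi) le_rfl
      rw [hker]
      refine Place.ext_ring (ValuationSubring.ext _ _ fun z => ?_)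
      have h1 := (Finset.mem_filter.1 hQ').2
      have h2 := SetLike.ext_iff.1 h1 ⟨z, hle z.2⟩
      exact h2.symm
    have hcard : (Finset.univ.filter fun Q' => ∀ i ∉ A, v Q' i = v Q i).card ≤
        ∏ i ∈ A, Module.finrank K (E i) := by
      rw [← Finset.card_image_of_injective _ hvinj]
      have hle : (Finset.univ.filter fun Q' => ∀ i ∉ A, v Q' i = v Q i).image v ⊆
          Fintype.piFinset fun i => if i ∈ A then G i else {v Q i} := by
        intro z hz
        obtain ⟨Q', hQ', rfl⟩ := Finset.mem_image.1 hz
        rw [Fintype.mem_piFinset]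
        intro i
        split_ifs with hi
        · exact hvG Q' i
        · exact Finset.mem_singleton.2 ((Finset.mem_filter.1 hQ').2 i hi)
      refine (Finset.card_le_card hle).trans ?_
      rw [Fintype.card_piFinset, ← Finset.prod_mul_prod_compl A]
      refine le_of_eq ?_
      rw [Finset.prod_congr rfl fun i hi => by rw [if_pos hi, hG],
        Finset.prod_eq_one (s := Aᶜ) fun i hi => by
          rw [if_neg (Finset.mem_compl.1 hi), Finset.card_singleton], mul_one]
    have heq := Finset.eq_of_subset_of_card_le hsub (hcard.trans (hcount A Q).ge)
    simpa using Finset.ext_iff.1 heq Q'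
  · rw [← hcount A Q, Set.encard_eq_coe_toFinset_card]
    congr 2
    ext
    simp

end Coordinates

/-! ### Parameters of the codes on fibers. -/

section FiberCodes

open Place

theorem Place.SameImage.mono {k K L : Type*} [Field k] [Field K] [Field L] [Algebra k L]
    [Algebra K L] {M N : IntermediateField K L} (hMN : M ≤ N) {Q Q' : Place k L}
    (h : SameImage N Q Q') : SameImage M Q Q' :=
  ValuationSubring.ext _ _ fun z => SetLike.ext_iff.1 h ⟨z, hMN z.2⟩

theorem Place.SameImage.liesOver {k K L : Type*} [Field k] [Field K] [Field L] [Algebra k K]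
    [Algebra k L] [Algebra K L] {P : Place k K} {M : IntermediateField K L} {Q Q' : Place k L}
    (h : SameImage M Q Q') (hQ : Q.LiesOver P) : Q'.LiesOver P := by
  refine Eq.trans ?_ hQ
  exact ValuationSubring.ext _ _ fun z => (SetLike.ext_iff.1 h (algebraMap K M z)).symm

variable {k K L : Type*} [Field k] [Field K] [Field L] [Algebra k K] [Algebra k L] [Algebra K L]
  [IsScalarTower k K L] {t : ℕ} {E : Fin t → IntermediateField K L} {P : Place k K}

theorem partialCompositum_anti {A B : Set (Fin t)} (h : A ⊆ B) :
    partialCompositum E B ≤ partialCompositum E A :=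
  biSup_mono fun _ hi hiA => hi (h hiA)

theorem mem_ring_of_mem_riemannRochSpace {D : Place k K →₀ ℕ} {f : K}
    (hf : f ∈ riemannRochSpace D) (hP : D P = 0) : f ∈ P.ring := by
  have := hf P 1 (by rw [hP, pow_zero, Ideal.one_eq_top]; trivial)
  simpa using this

/-- A factor `f ∈ ℒ(D)` is regular at the rational point `P` because `D P = 0`, so it contributes
one constant on the whole fiber. -/
theorem exists_polynomial_of_mem_evaluationSpace {y : ∀ j, E j} {ρ : Fin t → ℕ}
    {D : Place k K →₀ ℕ} (hP : P.IsRational) (hD : D P = 0) {v : rationalFiber L P → Fin t → k}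
    (hv : ∀ (Q : rationalFiber L P) j, Q.1.HasValue (y j : L) (v Q j)) {f : L} (hf : f ∈ evaluationSpace E y ρ D) :
    ∃ p ∈ boundedPolynomialFunctions k fun j => Module.finrank K (E j) - ρ j,
      ∀ Q : rationalFiber L P, Q.1.HasValue f (p (v Q)) := by
  induction hf using Submodule.span_induction with
  | mem f hf =>
    obtain ⟨g, hg, e, he, rfl⟩ := hf
    obtain ⟨c, hc⟩ := hP g (mem_ring_of_mem_riemannRochSpace hg hD)
    refine ⟨c • fun x => ∏ i, x i ^ e i, Submodule.smul_mem _ _ (Submodule.subset_span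
      ⟨e, fun j => Nat.le_sub_of_add_le (he j), rfl⟩), fun Q => ?_⟩
    exact (Q.2.2.hasValue_iff.2 hc).mul (HasValue.prod fun i _ => (hv Q i).pow (e i))
  | zero => exact ⟨0, Submodule.zero_mem _, fun Q => HasValue.zero Q.1⟩
  | add f g _ _ hf hg =>
    obtain ⟨p, hp, hpf⟩ := hf
    obtain ⟨q, hq, hqg⟩ := hg
    exact ⟨p + q, Submodule.add_mem _ hp hq, fun Q => (hpf Q).add (hqg Q)⟩
  | smul c f _ hf =>
    obtain ⟨p, hp, hpf⟩ := hf
    exact ⟨c • p, Submodule.smul_mem _ c hp, fun Q => (hpf Q).smul c⟩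

/-- The fibers of the maps to partial fiber products carry products of Reed–Solomon codes. -/
theorem fiberThrough_parameters [Finite k] (hdisj : LinearlyDisjointFamily E) (hX : ⨆ j, E j = ⊤)
    (y : ∀ j, E j) (D : Place k K →₀ ℕ) (S : Finset (Place k K))
    (hSrat : ∀ P ∈ S, P.IsRational)
    (hSsplit : ∀ P ∈ S, (rationalFiber L P).encard = (Module.finrank K L : ℕ∞))
    (hSpole : ∀ P ∈ S, ∀ Q : Place k L, Q.LiesOver P → ∀ j, (y j : L) ∈ Q.ring)
    (hSD : ∀ P ∈ S, D P = 0)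
    (hSinj : ∀ P ∈ S, ∀ j, ∀ R R' : Place k (E j), R.IsRational → R'.IsRational →
      R.LiesOver P → R'.LiesOver P → ∀ c : k, R.HasValue (y j) c → R'.HasValue (y j) c → R = R')
    (ρ : Fin t → ℕ) (hρ : ∀ j, 1 ≤ ρ j ∧ ρ j ≤ Module.finrank K (E j)) (A : Finset (Fin t))
    (Q : evaluationPoints L S) :
    (fiberThrough E S A Q).encard = ((∏ i ∈ A, Module.finrank K (E i) : ℕ) : ℕ∞) ∧
    Module.finrank k (puncturedCode (fiberProductCode E y ρ D S) (fiberThrough E S A Q)) ≤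
      ∏ i ∈ A, (Module.finrank K (E i) - ρ i + 1) ∧
    MinDistAtLeast (puncturedCode (fiberProductCode E y ρ D S) (fiberThrough E S A Q))
      (∏ i ∈ A, ρ i) := by
  classical
  obtain ⟨P, hPS, hQP⟩ := Q.2.2
  obtain ⟨v, G, hv, hG, hvinj, hvG, hfib, hcount⟩ := exists_coordinates hdisj hX
    (fun j => (hρ j).1.trans (hρ j).2) y (hSsplit P hPS)
    (fun Q hQ j => hSpole P hPS Q hQ.2 j) (hSinj P hPS)
  let Q₀ : rationalFiber L P := ⟨Q.1, Q.2.1, hQP⟩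
  let i : rationalFiber L P → evaluationPoints L S := fun R => ⟨R.1, R.2.1, P, hPS, R.2.2⟩
  have hi : Function.Injective i := fun R R' h => Subtype.ext (congrArg (fun x => x.1) h)
  let π : fiberThrough E S (A : Set (Fin t)) Q → rationalFiber L P := fun R =>
    ⟨R.1.1, R.1.2.1, Place.SameImage.liesOver R.2 hQP⟩
  have hπ : ∀ R, ∀ j ∉ A, v (π R) j = v Q₀ j := fun R => (hfib A Q₀ (π R)).1 R.2
  have hword : puncturedCode (fiberProductCode E y ρ D S) (fiberThrough E S A Q) ≤
      (boundedPolynomialFunctions k fun j => Module.finrank K (E j) - ρ j).map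
        (LinearMap.funLeft k k fun R => v (π R)) := by
    rintro _ ⟨c, ⟨f, hf, hfc⟩, rfl⟩
    obtain ⟨p, hp, hpf⟩ := exists_polynomial_of_mem_evaluationSpace (hSrat P hPS) (hSD P hPS) hv hf
    exact ⟨p, hp, funext fun R => (hpf (π R)).unique (hfc R.1)⟩
  refine ⟨?_, finrank_map_boundedPolynomialFunctions_le _ A (v Q₀) hπ hword, ?_⟩
  · have himage : fiberThrough E S A Q = i '' {R : rationalFiber L P |
        SameImage (partialCompositum E (A : Set (Fin t))) Q₀.1 R.1} := by
      refine Set.Subset.antisymm (fun R hR => ⟨π ⟨R, hR⟩, hR, rfl⟩) ?_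
      rintro _ ⟨R, hR, rfl⟩
      exact hR
    rw [himage, hi.encard_image, hcount]
  · intro c hc c' hc' hne
    -- By linearity it suffices to count the nonzeros of the polynomial representing `c - c'`.
    obtain ⟨p, hp, hpc⟩ := hword (Submodule.sub_mem _ hc hc')
    have hdiff : ∀ R, p (v (π R)) = c R - c' R := fun R => congrFun hpc R
    obtain ⟨R₀, hR₀⟩ := Function.ne_iff.1 hne
    have hcard := prod_le_card_nonzeros hp G A (v (π R₀)) ((hvG _).1 ⟨_, rfl⟩)
      (by rw [hdiff]; exact sub_ne_zero.2 hR₀)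
    -- The degree bound `d_j - ρ_j` on a set of `d_j` values leaves `ρ_j` nonzeros; `ρ_j ≤ d_j`
    -- makes the natural subtraction exact.
    rw [Finset.prod_congr rfl fun j _ => by
      rw [hG, Nat.sub_sub_self (hρ j).2]] at hcard
    refine (Nat.cast_le.2 hcard).trans ?_
    rw [← Set.encard_coe_eq_coe_finsetCard]
    refine (Set.encard_le_encard ?_).trans (Set.encard_image_le (fun R => v (π R)) _)
    intro z hz
    obtain ⟨hzG, hzA, hz0⟩ := (@Finset.mem_filter _ _ (_) _ _).1 (Finset.mem_coe.1 hz)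
    -- Fullness of the grid is used here: every nonzero of `p` in the slice is realized by a
    -- position of the code.
    obtain ⟨R, rfl⟩ := (hvG z).2 (Fintype.mem_piFinset.1 hzG)
    have hR : SameImage (partialCompositum E (A : Set (Fin t))) Q₀.1 R.1 :=
      (hfib A Q₀ R).2 fun j hj => (hzA j hj).trans (hπ R₀ j hj)
    refine ⟨⟨i R, hR⟩, fun h => hz0 ?_, rfl⟩
    have := hdiff ⟨i R, hR⟩
    rwa [h, sub_self] at this

end FiberCodes

/-! ### Monotonicity of the parameters, and assembly. -/

section ProductBounds

theorem prod_Ici_strictAnti {H : ℕ} {f : Fin H → ℕ} (h1 : ∀ j, 1 ≤ f j)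
    (h2 : ∀ j : Fin H, (j : ℕ) + 1 < H → 2 ≤ f j) :
    StrictAnti fun j : Fin H => ∏ l ∈ Finset.Ici j, f l := by
  intro i j hij
  -- Only a nonlast factor is dropped in passing from `i` to a later `j`, so the last factor may be
  -- `1`.
  have hi : 2 ≤ f i := h2 i (by have : (i : ℕ) < j := hij; omega)
  have hsub : insert i (Finset.Ici j) ⊆ Finset.Ici i :=
    Finset.insert_subset (by simp) (Finset.Ici_subset_Ici.2 hij.le)
  have hpos : 0 < ∏ l ∈ Finset.Ici j, f l := Finset.prod_pos fun l _ => h1 l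
  have hle := Finset.prod_le_prod_of_subset_of_one_le' (f := f) hsub fun l _ _ => h1 l
  rw [Finset.prod_insert (by simpa using hij)] at hle
  exact lt_of_lt_of_le (by nlinarith) hle

theorem prod_Ici_antitone {H : ℕ} {f : Fin H → ℕ} (h1 : ∀ j, 1 ≤ f j) :
    Antitone fun j : Fin H => ∏ l ∈ Finset.Ici j, f l := fun _ _ hij =>
  Finset.prod_le_prod_of_subset_of_one_le' (Finset.Ici_subset_Ici.2 hij) fun l _ _ => h1 l

end ProductBounds

theorem mainTheorem2
    {k K L : Type*} [Field k] [Finite k] [Field K] [Field L]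
    [Algebra k K] [Algebra k L] [Algebra K L] [IsScalarTower k K L]
    {t : ℕ} (E : Fin t → IntermediateField K L)
    -- the curves `𝒴`, `𝒴_j`, the separable maps `h_j : 𝒴_j → 𝒴`, and the fiber product `𝒳`
    (hY : IsCurveFunctionField k K)
    (hYj : ∀ j, IsCurveFunctionField k (E j))
    (hsep : ∀ j, Algebra.IsSeparable K (E j))
    (hdisj : LinearlyDisjointFamily E)
    (hX : ⨆ j, E j = ⊤)
    -- primitive elements of `E j / K`
    (y : ∀ j, E j)
    (hy : ∀ j, IntermediateField.adjoin K {y j} = ⊤)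
    -- the effective divisor `D` and the set `S` of rational points on `𝒴`
    (D : Place k K →₀ ℕ) (S : Finset (Place k K))
    (hSrat : ∀ P ∈ S, P.IsRational)
    (hSsplit : ∀ P ∈ S, {Q : Place k L | Q.IsRational ∧ Q.LiesOver P}.encard =
      (Module.finrank K L : ℕ∞))
    (hSpole : ∀ P ∈ S, ∀ Q : Place k L, Q.LiesOver P → ∀ j, (y j : L) ∈ Q.ring)
    (hSD : ∀ P ∈ S, D P = 0)
    -- `y_j` takes distinct values at distinct rational points of `𝒴_j` over a point of `S`
    (hSinj : ∀ P ∈ S, ∀ j, ∀ R R' : Place k (E j), R.IsRational → R'.IsRational →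
      R.LiesOver P → R'.LiesOver P → ∀ c : k, R.HasValue (y j) c → R'.HasValue (y j) c → R = R')
    -- the local distances and the number of levels
    (ρ : Fin t → ℕ) (hρ : ∀ j, 1 ≤ ρ j ∧ ρ j ≤ Module.finrank K (E j))
    (H : ℕ) (hH : 2 ≤ H) (hHt : H ≤ t)
    (hρH : ∀ j : Fin t, (j : ℕ) + 1 < H → 2 ≤ ρ j) :
    HasHierarchicalLocalityVia (fiberProductCode E y ρ D S)
      (fun j : Fin H => ∏ l ∈ Finset.Ici j, Module.finrank K (E (Fin.castLE hHt l)))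
      (fun j : Fin H => ∏ l ∈ Finset.Ici j,
        (Module.finrank K (E (Fin.castLE hHt l)) - ρ (Fin.castLE hHt l) + 1))
      (fun j : Fin H => ∏ l ∈ Finset.Ici j, ρ (Fin.castLE hHt l))
      (fun j : Fin H => fiberThrough E S (Fin.castLE hHt '' Set.Ici j)) := by

  have hd1 : ∀ j, 1 ≤ Module.finrank K (E j) := fun j => (hρ j).1.trans (hρ j).2
  have hset : ∀ j : Fin H, Fin.castLE hHt '' Set.Ici j =
      (((Finset.Ici j).map (Fin.castLEEmb hHt) : Finset (Fin t)) : Set (Fin t)) := fun j => by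
    simp
  have hpar := fun (j : Fin H) Q => fiberThrough_parameters hdisj hX y D S hSrat hSsplit hSpole hSD
    hSinj ρ hρ ((Finset.Ici j).map (Fin.castLEEmb hHt)) Q
  simp only [Finset.prod_map] at hpar
  simp_rw [hset]
  let A : Fin H → Finset (Fin t) := fun j => (Finset.Ici j).map (Fin.castLEEmb hHt)
  have hanti : ∀ {i j : Fin H}, i ≤ j →
      partialCompositum E (A i : Set (Fin t)) ≤ partialCompositum E (A j : Set (Fin t)) := fun hij =>
    partialCompositum_anti (Finset.coe_subset.2 (Finset.map_subset_map.2
      (Finset.Ici_subset_Ici.2 hij)))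
  exact
    { two_le := hH
      n_pos := fun j => Finset.prod_pos fun l _ => hd1 _
      s_pos := fun j => Finset.prod_pos fun l _ => Nat.succ_pos _
      δ_pos := fun j => Finset.prod_pos fun l _ => (hρ _).1
      n_strictAnti := prod_Ici_strictAnti (fun l => hd1 _) fun l hl =>
        (hρH (Fin.castLE hHt l) hl).trans (hρ _).2
      s_antitone := prod_Ici_antitone fun l => Nat.succ_pos _
      δ_strictAnti := prod_Ici_strictAnti (fun l => (hρ _).1) fun l hl => hρH (Fin.castLE hHt l) hl
      mem := fun j Q => rfl
      length := fun j Q => (hpar j Q).1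
      nested := fun Q i j hij Q' hQ' => Place.SameImage.mono (hanti hij) hQ'
      dim_le := fun j Q => (hpar j Q).2.1
      dist := fun j Q => (hpar j Q).2.2
      -- A deeper level compares images on a larger partial fiber product, so its relation refines
      -- that of level `j`; transitivity does the rest.
      recursive := fun j l hjl Q Q' hQ' Q'' hQ'' =>
        hQ'.trans (Place.SameImage.mono (hanti hjl.le) hQ'') }
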